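/- Let $X$ be a real or complex Banach space and let $T:X\to X$ be a bounded linear operator that is power bounded, i.e. $\sup_{n\ge 0}\|T^n\|<\infty$. For $Y\subseteq X$ write $\rho(x,Y)=\inf_{y\in Y}\|x-y\|$ (with $\inf\emptyset=\infty$), and call $a\in X$ a returning vector of $T$ if $\liminf_{n\to\infty}\|T^na-a\|=0$. Suppose there is a compact set $K\subseteq X$ such that $\liminf_{n\to\infty}\rho(T^nx,K)=0$ for every $x\in X$ with $\|x\|\le 1$. Let $L$ be the linear span of all returning vectors of $T$, and let $X_0=\{x\in X: T^nx\to 0\}$. Then $L$ is finite-dimensional, $T(L)\subseteq L$, and $\lim_{n\to\infty}\rho(T^nx,L)=0$ for every $x\in X$. Moreover $X_0$ is a $T$-invariant linear subspace, $X=X_0\oplus L$ as a topological direct sum, and $T^n=(T|_{X_0})^n\oplus(T|_L)^n$ with respect to this decomposition for every $n\ge 0$. -/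

import Mathlib

open Filter Topology

section

variable {𝕜 X : Type*} [RCLike 𝕜] [NormedAddCommGroup X] [NormedSpace 𝕜 X]

/-- `T` is power bounded: the norms of its powers are bounded. -/
def PowerBounded (T : X →L[𝕜] X) : Prop :=
  ∃ C : ℝ, ∀ n : ℕ, ‖T ^ n‖ ≤ C

/-- `K` is occasionally attracting for `T`: `liminf ρ(T ^ n x, K) = 0` for all `x` in the closed
unit ball. The distance takes values in `[0, ∞]`, so the empty set attracts nothing. -/
def OccasionallyAttracting (T : X →L[𝕜] X) (K : Set X) : Prop :=
  ∀ x : X, ‖x‖ ≤ 1 → liminf (fun n : ℕ => Metric.infEDist ((T ^ n) x) K) atTop = 0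

/-- `a` is a returning vector of `T`: `liminf ‖T ^ n a - a‖ = 0`, the liminf being taken
in `[0, ∞]`. -/
def IsReturning (T : X →L[𝕜] X) (a : X) : Prop :=
  liminf (fun n : ℕ => ‖(T ^ n) a - a‖ₑ) atTop = 0

/-- The subspace `X₀` of all `x` with `T ^ n x → 0`. -/
def vanishingSubspace (T : X →L[𝕜] X) : Submodule 𝕜 X where
  carrier := {x | Tendsto (fun n : ℕ => (T ^ n) x) atTop (𝓝 0)}
  zero_mem' := by simp
  add_mem' := by
    intro x y hx hy
    simpa only [Set.mem_setOf_eq, map_add, add_zero] using Tendsto.add hx hy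
  smul_mem' := by
    intro c x hx
    simpa only [Set.mem_setOf_eq, map_smul, smul_zero] using Tendsto.const_smul hx c

/-- `X` is the topological direct sum of the `T`-invariant subspaces `X₀` and `L`, and
`T ^ n = (T|X₀) ^ n ⊕ (T|L) ^ n` for all `n`. -/
def DecomposesAlong (T : X →L[𝕜] X) (X₀ L : Submodule 𝕜 X) : Prop :=
  X₀.IsTopCompl L ∧
  ∃ (h₀ : Set.MapsTo T X₀ X₀) (hL : Set.MapsTo T L L),
    ∀ (n : ℕ) (x₀ : X₀) (l : L),
      (T ^ n) ((x₀ : X) + (l : X)) =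
        (((T.restrict h₀) ^ n) x₀ : X) + (((T.restrict hL) ^ n) l : X)

end

/-! The upper limit of `‖T ^ n x‖` is a seminorm that `T` preserves and whose kernel is `X₀`.
Completing `X` for it gives an isometry `S` of a Banach space `Y` and a map `π : X → Y` with kernel
`X₀`. The compact set enters only through `OrbitCompact`, which passes to `S`. `Y` is
finite-dimensional. Recurrence makes `S` map closed invariant subspaces onto themselves, so distance
to them is constant along orbits. Riesz vectors then exclude infinite strict chains of such
subspaces. Descending chains force injective operators commuting with `S` to be onto, as for compact
perturbations of the identity; so a singular real quadratic in `S` has a kernel, and hence a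
finite-dimensional invariant subspace exists. Ascending chains give a maximal one, which must be
`Y`, since otherwise its quotient would yield a larger one. Powers of `S` now return to the identity
along one filter of times, and all returning vectors return along it, so they form a subspace `L`.
On `L` the seminorm dominates the norm, so `π` is injective there; orbit limit points lie in `L` and
give `π(L) = π(X)`. Hence `X = X₀ ⊕ L`. -/

section Complexification

/-! ### Complexification and singular real quadratics. -/

variable {M : Type*} [NormedAddCommGroup M] [NormedSpace ℝ M]

variable (M) in
/-- The complexification of a real normed space `M`, realized as the space of real-linear maps
`ℂ → M`, on which `ℂ` acts by multiplication of the argument. -/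
def Complexified : Type _ := ℂ →L[ℝ] M

namespace Complexified

noncomputable instance : NormedAddCommGroup (Complexified M) :=
  inferInstanceAs (NormedAddCommGroup (ℂ →L[ℝ] M))

instance [CompleteSpace M] : CompleteSpace (Complexified M) :=
  inferInstanceAs (CompleteSpace (ℂ →L[ℝ] M))

noncomputable instance : FunLike (Complexified M) ℂ M := inferInstanceAs (FunLike (ℂ →L[ℝ] M) ℂ M)

@[ext] lemma ext {f g : Complexified M} (h : ∀ w, f w = g w) : f = g := DFunLike.ext _ _ h

@[simp] lemma add_apply (f g : Complexified M) (w : ℂ) : (f + g) w = f w + g w := rfl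

@[simp] lemma zero_apply (w : ℂ) : (0 : Complexified M) w = 0 := rfl

lemma map_add_arg (f : Complexified M) (v w : ℂ) : f (v + w) = f v + f w :=
  ContinuousLinearMap.map_add (f : ℂ →L[ℝ] M) v w

lemma map_smul_arg (f : Complexified M) (r : ℝ) (w : ℂ) : f (r • w) = r • f w :=
  ContinuousLinearMap.map_smul (f : ℂ →L[ℝ] M) r w

noncomputable instance : SMul ℂ (Complexified M) :=
  ⟨fun z f => (f : ℂ →L[ℝ] M).comp (ContinuousLinearMap.mul ℝ ℂ z)⟩

@[simp] lemma smul_apply (z : ℂ) (f : Complexified M) (w : ℂ) : (z • f) w = f (z * w) := rfl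

noncomputable instance : Module ℂ (Complexified M) where
  one_smul f := by ext w; simp
  mul_smul z z' f := by ext w; simp [mul_left_comm, mul_assoc]
  smul_zero z := by ext w; simp
  smul_add z f g := by ext w; simp
  add_smul z z' f := by ext w; simp [add_mul, map_add_arg]
  zero_smul f := by
    ext w
    simpa using map_smul_arg f 0 0

noncomputable instance : NormedSpace ℂ (Complexified M) where
  norm_smul_le z f := by
    rw [mul_comm]
    refine (ContinuousLinearMap.opNorm_comp_le (f : ℂ →L[ℝ] M)
      (ContinuousLinearMap.mul ℝ ℂ z)).trans ?_
    gcongr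
    · exact le_rfl
    · exact ContinuousLinearMap.opNorm_mul_apply_le ℝ ℂ z

/-- The complexification of a bounded real-linear operator. -/
noncomputable def map (T : M →L[ℝ] M) : Complexified M →L[ℂ] Complexified M :=
  LinearMap.mkContinuous
    { toFun := fun f => (T.comp (f : ℂ →L[ℝ] M) : ℂ →L[ℝ] M)
      map_add' := fun f g => T.comp_add (f : ℂ →L[ℝ] M) (g : ℂ →L[ℝ] M)
      map_smul' := fun _ _ => rfl } ‖T‖
    (fun f => T.opNorm_comp_le (f : ℂ →L[ℝ] M))

@[simp] lemma map_apply (T : M →L[ℝ] M) (f : Complexified M) (w : ℂ) : map T f w = T (f w) := rfl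

lemma map_mul (S T : M →L[ℝ] M) : map (S * T) = map S * map T := rfl

lemma map_one : map (1 : M →L[ℝ] M) = 1 := rfl

lemma isUnit_map {T : M →L[ℝ] M} (hT : IsUnit T) : IsUnit (map T) := by
  obtain ⟨U, rfl⟩ := hT
  exact ⟨⟨map U, map ↑U⁻¹, by rw [← map_mul, U.mul_inv, map_one],
    by rw [← map_mul, U.inv_mul, map_one]⟩, rfl⟩

lemma sub_apply (f g : Complexified M) (w : ℂ) : (f - g) w = f w - g w := rfl

instance [Nontrivial M] : Nontrivial (Complexified M) := by
  obtain ⟨x, hx⟩ := exists_ne (0 : M)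
  refine ⟨(Complex.reCLM.smulRight x : ℂ →L[ℝ] M), 0, fun h => hx ?_⟩
  have h₁ : (1 : ℂ).re • x = 0 := congrArg (fun f : Complexified M => f 1) h
  simpa using h₁

end Complexified

/-- Every bounded operator on a nonzero real Banach space becomes singular when inserted into a
suitable monic real quadratic polynomial. -/
theorem exists_not_isUnit_quadratic [CompleteSpace M] [Nontrivial M] (T : M →L[ℝ] M) :
    ∃ a b : ℝ, ¬ IsUnit (T ^ 2 - a • T + b • (1 : M →L[ℝ] M)) := by
  -- The quadratic is `(t - z)(t - conj z)`, which factors over the complexification; its commuting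
  -- factor `z - T` is singular.
  obtain ⟨z, hz⟩ := spectrum.nonempty (Complexified.map T)
  refine ⟨2 * z.re, Complex.normSq z, fun h => ?_⟩
  have hfac : Complexified.map (T ^ 2 - (2 * z.re) • T + Complex.normSq z • (1 : M →L[ℝ] M)) =
      (algebraMap ℂ _ z - Complexified.map T) *
        (algebraMap ℂ _ (starRingEnd ℂ z) - Complexified.map T) := by
    ext f w
    have h₁ : (starRingEnd ℂ z) * (z * w) = Complex.normSq z • w := by
      rw [← mul_assoc, mul_comm _ z, Complex.mul_conj, Complex.real_smul]
    have h₂ : (2 * z.re) • w = z * w + starRingEnd ℂ z * w := by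
      rw [← add_mul, Complex.add_conj, Complex.real_smul]
    have h₃ : (2 * z.re) • f w = f (z * w) + f (starRingEnd ℂ z * w) := by
      rw [← Complexified.map_smul_arg, h₂, Complexified.map_add_arg]
    have h₄ : f (starRingEnd ℂ z * (z * w)) = Complex.normSq z • f w := by
      rw [h₁, Complexified.map_smul_arg]
    have h₅ := congrArg T h₃
    rw [map_smul, map_add] at h₅
    have h₆ : ((algebraMap ℂ _ z - Complexified.map T) *
        (algebraMap ℂ _ (starRingEnd ℂ z) - Complexified.map T)) f w =
        (f (starRingEnd ℂ z * (z * w)) - T (f (z * w))) -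
          (T (f (starRingEnd ℂ z * w)) - T (T (f w))) := by
      simp [Complexified.sub_apply, Algebra.algebraMap_eq_smul_one]
    have h₇ : Complexified.map (T ^ 2 - (2 * z.re) • T + Complex.normSq z • (1 : M →L[ℝ] M)) f w =
        T (T (f w)) - (2 * z.re) • T (f w) + Complex.normSq z • f w := by
      simp [pow_two]
    rw [h₆, h₇, h₅, h₄]
    abel
  have hu := Complexified.isUnit_map h
  rw [hfac, Commute.isUnit_mul_iff] at hu
  · exact hz hu.1
  · exact ((Algebra.commute_algebraMap_left _ _).sub_left
      ((Algebra.commute_algebraMap_right _ _).sub_right (Commute.refl _)))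

end Complexification

/-! ### Isometries with compact orbit space. -/

section OrbitCompact

variable {𝕜 : Type*} [RCLike 𝕜]

/-- Every bounded sequence has a subsequence which converges after each of its terms has been
moved along its `T`-orbit. -/
def OrbitCompact {Y : Type*} [NormedAddCommGroup Y] [NormedSpace 𝕜 Y] (T : Y →L[𝕜] Y) : Prop :=
  ∀ (R : ℝ) (x : ℕ → Y), (∀ n, ‖x n‖ ≤ R) →
    ∃ (k φ : ℕ → ℕ) (y : Y), StrictMono φ ∧
      Tendsto (fun n => (T ^ k n) (x (φ n))) atTop (𝓝 y)

variable {Y : Type*} [NormedAddCommGroup Y] [NormedSpace 𝕜 Y] {T : Y →L[𝕜] Y}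

lemma norm_pow_apply_of_isometry (hT : ∀ x, ‖T x‖ = ‖x‖) (n : ℕ) (x : Y) :
    ‖(T ^ n) x‖ = ‖x‖ := by
  induction n with
  | zero => simp
  | succ n ih => rw [pow_succ', mul_apply_eq_comp, hT, ih]

lemma mapsTo_pow {F : Set Y} (hF : Set.MapsTo T F F) (n : ℕ) : Set.MapsTo (T ^ n) F F := by
  induction n with
  | zero => simpa using Set.mapsTo_id F
  | succ n ih => rw [pow_succ]; exact ih.comp hF

/-- Every orbit has a limit point along a sequence of times tending to infinity. -/
lemma OrbitCompact.exists_tendsto (hO : OrbitCompact T) {C : ℝ} (hC : ∀ n, ‖T ^ n‖ ≤ C) (x : Y) :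
    ∃ (m : ℕ → ℕ) (y : Y), Tendsto m atTop atTop ∧
      Tendsto (fun n => (T ^ m n) x) atTop (𝓝 y) := by
  obtain ⟨k, φ, y, hφ, hy⟩ := hO (C * ‖x‖) (fun n => (T ^ n) x)
    fun n => (T ^ n).le_of_opNorm_le (hC n) x
  refine ⟨fun n => k n + φ n, y, ?_, ?_⟩
  · exact tendsto_atTop_mono (fun n => Nat.le_add_left _ _) hφ.tendsto_atTop
  · simpa only [pow_add, mul_apply_eq_comp] using hy

lemma norm_pow_le_one_of_isometry (hT : ∀ x, ‖T x‖ = ‖x‖) (n : ℕ) : ‖T ^ n‖ ≤ 1 :=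
  ContinuousLinearMap.opNorm_le_bound _ zero_le_one fun x => by
    rw [norm_pow_apply_of_isometry hT, one_mul]

/-- Isometries with compact orbit space are recurrent. -/
lemma OrbitCompact.exists_norm_sub_lt (hO : OrbitCompact T) (hT : ∀ x, ‖T x‖ = ‖x‖) (x : Y)
    {ε : ℝ} (hε : 0 < ε) : ∃ j, ‖(T ^ (j + 1)) x - x‖ < ε := by
  obtain ⟨m, y, hm, hy⟩ := hO.exists_tendsto (norm_pow_le_one_of_isometry hT) x
  obtain ⟨N, hN⟩ := Metric.cauchySeq_iff.1 hy.cauchySeq ε hε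
  obtain ⟨n, hn, hmn⟩ := ((eventually_ge_atTop N).and (hm.eventually_gt_atTop (m N))).exists
  refine ⟨m n - m N - 1, ?_⟩
  have h := hN n hn N le_rfl
  -- The isometry `T ^ m N` can be cancelled from the difference of two orbit points.
  have hmn' : m n = m N + (m n - m N - 1 + 1) := by omega
  rwa [dist_eq_norm, hmn', pow_add, mul_apply_eq_comp, ← map_sub,
    norm_pow_apply_of_isometry hT] at h

/-- By recurrence, a point of `F` is a limit of points `T ^ (j + 1) x` of `T(F)`, and `T(F)` is
closed because `T` is a closed embedding. -/
lemma OrbitCompact.surjOn [CompleteSpace Y] (hO : OrbitCompact T)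
    (hT : ∀ x, ‖T x‖ = ‖x‖) {F : Submodule 𝕜 Y}
    (hF : IsClosed (F : Set Y)) (hTF : Set.MapsTo T F F) : Set.SurjOn T F F := by
  intro x hx
  have hiso : Isometry T := AddMonoidHomClass.isometry_of_norm T hT
  rw [← (hiso.isClosedEmbedding.isClosedMap _ hF).closure_eq, Metric.mem_closure_iff]
  intro ε hε
  obtain ⟨j, hj⟩ := hO.exists_norm_sub_lt hT x hε
  refine ⟨(T ^ (j + 1)) x, ⟨(T ^ j) x, mapsTo_pow hTF j hx, ?_⟩, ?_⟩
  · rw [pow_succ', mul_apply_eq_comp]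
  · rwa [dist_comm, dist_eq_norm]

/-- Moving a point along its orbit does not bring it closer to a closed invariant subspace. -/
lemma OrbitCompact.le_norm_pow_sub [CompleteSpace Y] (hO : OrbitCompact T)
    (hT : ∀ x, ‖T x‖ = ‖x‖) {F : Submodule 𝕜 Y} (hF : IsClosed (F : Set Y))
    (hTF : Set.MapsTo T F F) {x : Y} {c : ℝ}
    (hx : ∀ y ∈ F, c ≤ ‖x - y‖) (n : ℕ) : ∀ y ∈ F, c ≤ ‖(T ^ n) x - y‖ := by
  induction n with
  | zero => simpa using hx
  | succ n ih =>
    intro y hy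
    obtain ⟨z, hz, rfl⟩ := hO.surjOn hT hF hTF hy
    rw [pow_succ', mul_apply_eq_comp, ← map_sub, hT]
    exact ih z hz

/-- A bounded sequence does not have uniformly separated orbits. -/
lemma OrbitCompact.not_separated (hO : OrbitCompact T) {R : ℝ} {f : ℕ → Y}
    (hR : ∀ n, ‖f n‖ ≤ R) (hsep : ∀ m n, m < n → ∀ k l, 1 ≤ ‖(T ^ k) (f m) - (T ^ l) (f n)‖) :
    False := by
  obtain ⟨k, φ, y, hφ, hy⟩ := hO R f hR
  obtain ⟨N, hN⟩ := Metric.cauchySeq_iff.1 hy.cauchySeq 1 one_pos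
  have h := hN N le_rfl (N + 1) N.le_succ
  rw [dist_eq_norm] at h
  exact absurd h (not_lt.2 (hsep _ _ (hφ N.lt_succ_self) _ _))

/-- Riesz's lemma for a closed subspace of another subspace. -/
lemma exists_mem_norm_le_three_of_lt {V W : Submodule 𝕜 Y} (hV : IsClosed (V : Set Y))
    (hVW : V < W) : ∃ x ∈ W, ‖x‖ ≤ 3 ∧ ∀ y ∈ V, 1 ≤ ‖x - y‖ := by
  have h₁ : IsClosed ((V.comap W.subtype : Submodule 𝕜 W) : Set W) := hV.preimage_val
  obtain ⟨x, hxW, hxV⟩ := SetLike.exists_of_lt hVW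
  obtain ⟨⟨z, hzW⟩, hz, hzV⟩ := riesz_lemma_of_norm_lt (𝕜 := 𝕜) (c := 2) (R := 3) (by simp)
    (by simp; norm_num) h₁ ⟨⟨x, hxW⟩, hxV⟩
  exact ⟨z, hzW, hz, fun y hy => hzV ⟨y, hVW.le hy⟩ hy⟩

/-- Strictly decreasing sequences of closed invariant subspaces do not exist. -/
lemma OrbitCompact.not_strictAnti [CompleteSpace Y] (hO : OrbitCompact T)
    (hT : ∀ x, ‖T x‖ = ‖x‖) {V : ℕ → Submodule 𝕜 Y} (hV : ∀ n, IsClosed (V n : Set Y))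
    (hTV : ∀ n, Set.MapsTo T (V n) (V n)) (hanti : StrictAnti V) : False := by
  choose f hfV hf3 hf using
    fun n => exists_mem_norm_le_three_of_lt (hV (n + 1)) (hanti n.lt_succ_self)
  -- For `m < n` the orbit of `f n` stays in `V (m + 1)`, and the orbit of `f m` keeps distance at
  -- least 1 from it.
  refine hO.not_separated hf3 fun m n hmn k l => ?_
  exact hO.le_norm_pow_sub hT (hV _) (hTV _) (hf m) k _
    (mapsTo_pow (hTV _) l (hanti.antitone hmn (hfV n)))

/-- Strictly increasing sequences of closed invariant subspaces do not exist. -/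
lemma OrbitCompact.not_strictMono [CompleteSpace Y] (hO : OrbitCompact T)
    (hT : ∀ x, ‖T x‖ = ‖x‖) {V : ℕ → Submodule 𝕜 Y} (hV : ∀ n, IsClosed (V n : Set Y))
    (hTV : ∀ n, Set.MapsTo T (V n) (V n)) (hmono : StrictMono V) : False := by
  choose f hfV hf3 hf using
    fun n => exists_mem_norm_le_three_of_lt (hV n) (hmono n.lt_succ_self)
  refine hO.not_separated hf3 fun m n hmn k l => ?_
  rw [norm_sub_rev]
  exact hO.le_norm_pow_sub hT (hV _) (hTV _) (hf n) l _
    (mapsTo_pow (hTV _) k (hmono.monotone hmn (hfV m)))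

/-- An injective operator commuting with `T` is bounded below. -/
lemma OrbitCompact.antilipschitz (hO : OrbitCompact T) (hT : ∀ x, ‖T x‖ = ‖x‖) {D : Y →L[𝕜] Y}
    (hD : Commute D T) (hinj : Function.Injective D) : ∃ K, AntilipschitzWith K D := by
  rw [antilipschitzWith_iff_exists_mul_le_norm]
  by_contra! h
  have hx : ∀ n : ℕ, ∃ x, ‖x‖ = 1 ∧ ‖D x‖ < 1 / ((n : ℝ) + 1) := by
    intro n
    obtain ⟨x, hx⟩ := h (1 / ((n : ℝ) + 1)) (by positivity)
    have hx0 : x ≠ 0 := by rintro rfl; simp at hx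
    have hx0' : 0 < ‖x‖ := norm_pos_iff.2 hx0
    refine ⟨((‖x‖⁻¹ : ℝ) : 𝕜) • x, ?_, ?_⟩
    · rw [norm_smul, RCLike.norm_ofReal, abs_of_pos (by positivity)]
      exact inv_mul_cancel₀ hx0'.ne'
    · rw [map_smul, norm_smul, RCLike.norm_ofReal, abs_of_pos (by positivity)]
      rwa [inv_mul_lt_iff₀ hx0', mul_comm]
  choose x hx1 hxD using hx
  -- Moving along orbits changes neither `‖x n‖` nor `‖D (x n)‖`, so the limit is a unit vector in
  -- the kernel of `D`.
  obtain ⟨k, φ, y, hφ, hy⟩ := hO 1 x fun n => (hx1 n).le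
  have hy1 : ‖y‖ = 1 := by
    refine tendsto_nhds_unique hy.norm ?_
    simp only [norm_pow_apply_of_isometry hT, hx1, tendsto_const_nhds]
  have hlim : Tendsto (fun n => D ((T ^ k n) (x (φ n)))) atTop (𝓝 0) := by
    refine squeeze_zero_norm (a := fun n : ℕ => 1 / ((φ n : ℝ) + 1)) (fun n => ?_)
      (tendsto_one_div_add_atTop_nhds_zero_nat.comp hφ.tendsto_atTop)
    rw [← mul_apply_eq_comp, (hD.pow_right (k n)).eq, mul_apply_eq_comp,
      norm_pow_apply_of_isometry hT]
    exact (hxD _).le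
  have hDy : D y = 0 := tendsto_nhds_unique ((D.continuous.tendsto y).comp hy) hlim
  have : y = 0 := hinj (hDy.trans (map_zero D).symm)
  simp [this] at hy1

/-- An injective operator commuting with `T` is surjective. -/
lemma OrbitCompact.surjective [CompleteSpace Y] (hO : OrbitCompact T)
    (hT : ∀ x, ‖T x‖ = ‖x‖) {D : Y →L[𝕜] Y}
    (hD : Commute D T) (hinj : Function.Injective D) : Function.Surjective D := by
  obtain ⟨K, hK⟩ := hO.antilipschitz hT hD hinj
  by_contra hsurj
  have hcl := (hK.isClosedEmbedding D.uniformContinuous).isClosedMap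
  have hpow : ∀ n : ℕ, IsClosedMap (D ^ n : Y →L[𝕜] Y) ∧
      Function.Injective (D ^ n : Y →L[𝕜] Y) := by
    intro n
    induction n with
    | zero => exact ⟨IsClosedMap.id, Function.injective_id⟩
    | succ n ih => rw [pow_succ]; exact ⟨ih.1.comp hcl, ih.2.comp hinj⟩
  -- If `D` is injective but not onto, the closed ranges of its powers decrease strictly.
  refine hO.not_strictAnti hT (V := fun n => (D ^ n : Y →L[𝕜] Y).range) (fun n => ?_) (fun n => ?_)
    (strictAnti_nat_of_succ_lt fun n => ?_)
  · exact (hpow n).1.isClosed_range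
  · rintro _ ⟨x, rfl⟩
    refine ⟨T x, ?_⟩
    exact DFunLike.congr_fun (hD.pow_left n).eq x
  · refine SetLike.lt_iff_le_and_exists.2 ⟨?_, ?_⟩
    · rintro _ ⟨x, rfl⟩
      exact ⟨D x, by rw [pow_succ]; rfl⟩
    · simp only [Function.Surjective, not_forall] at hsurj
      obtain ⟨z, hz⟩ := hsurj
      refine ⟨(D ^ n) z, ⟨z, rfl⟩, ?_⟩
      rintro ⟨x, hx⟩
      refine hz ⟨x, (hpow n).2 ?_⟩
      rw [← hx, pow_succ]
      rfl

lemma mapsTo_span_of_quadratic_eq_zero {a b : 𝕜} {x : Y}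
    (hx : (T ^ 2 - a • T + b • (1 : Y →L[𝕜] Y)) x = 0) :
    Set.MapsTo T (Submodule.span 𝕜 {x, T x}) (Submodule.span 𝕜 {x, T x} : Submodule 𝕜 Y) := by
  intro y hy
  obtain ⟨c, d, rfl⟩ := Submodule.mem_span_pair.1 hy
  refine Submodule.mem_span_pair.2 ⟨-(d * b), c + d * a, ?_⟩
  have hx' : T (T x) = a • T x - b • x := by
    have : T (T x) - a • T x + b • x = 0 := by simpa [pow_two] using hx
    linear_combination (norm := module) this
  rw [map_add, map_smul, map_smul, hx']
  module

/-- An isometry of a nonzero space with compact orbit space has a nonzero finite-dimensional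
invariant subspace. -/
lemma OrbitCompact.exists_finiteDimensional_invariant [CompleteSpace Y] [Nontrivial Y]
    (hO : OrbitCompact T) (hT : ∀ x, ‖T x‖ = ‖x‖) :
    ∃ F : Submodule 𝕜 Y, F ≠ ⊥ ∧ FiniteDimensional 𝕜 F ∧ Set.MapsTo T F F := by
  let _ : NormedSpace ℝ Y := NormedSpace.restrictScalars ℝ 𝕜 Y
  have : IsScalarTower ℝ 𝕜 Y := RestrictScalars.isScalarTower ℝ 𝕜 Y
  obtain ⟨a, b, hab⟩ := exists_not_isUnit_quadratic (T.restrictScalars ℝ)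
  set D : Y →L[𝕜] Y := T ^ 2 - (a : 𝕜) • T + (b : 𝕜) • (1 : Y →L[𝕜] Y)
  have hD : Commute D T := by
    refine ((Commute.pow_left (Commute.refl T) 2).sub_left
      ((Commute.refl T).smul_left _)).add_left ((Commute.one_left T).smul_left _)
  have hDa : ∀ x, D x = T (T x) - a • T x + b • x := fun x => by
    simp [D, pow_two]
  have hninj : ¬ Function.Injective D := fun hinj => hab <| by
    rw [ContinuousLinearMap.isUnit_iff_bijective]
    have hbij : Function.Bijective D := ⟨hinj, hO.surjective hT hD hinj⟩
    convert hbij using 1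
    ext x
    rw [hDa]
    simp [pow_two]
  rw [injective_iff_map_eq_zero] at hninj
  push Not at hninj
  obtain ⟨x, hx, hx0⟩ := hninj
  refine ⟨Submodule.span 𝕜 {x, T x}, ?_, ?_, mapsTo_span_of_quadratic_eq_zero hx⟩
  · exact (Submodule.ne_bot_iff _).2 ⟨x, Submodule.subset_span (by simp), hx0⟩
  · exact FiniteDimensional.span_of_finite 𝕜 (by simp)

end OrbitCompact

/-! ### Passage to quotients and finite-dimensionality. -/

section Quotient

variable {𝕜 : Type*} [RCLike 𝕜]
variable {Y : Type*} [NormedAddCommGroup Y] [NormedSpace 𝕜 Y] {T : Y →L[𝕜] Y}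

/-- The operator induced on the quotient by an invariant subspace. -/
noncomputable def ContinuousLinearMap.quotientMap (T : Y →L[𝕜] Y) (F : Submodule 𝕜 Y)
    (hTF : Set.MapsTo T F F) : Y ⧸ F →L[𝕜] Y ⧸ F :=
  F.liftQL (F.mkQL.comp T) fun x hx => by
    simpa using hTF hx

lemma quotientMap_mk {F : Submodule 𝕜 Y} (hTF : Set.MapsTo T F F) (x : Y) :
    T.quotientMap F hTF (Submodule.Quotient.mk x) = Submodule.Quotient.mk (T x) := rfl

lemma quotientMap_pow_mk {F : Submodule 𝕜 Y} (hTF : Set.MapsTo T F F) (n : ℕ) (x : Y) :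
    (T.quotientMap F hTF ^ n) (Submodule.Quotient.mk x) = Submodule.Quotient.mk ((T ^ n) x) := by
  induction n generalizing x with
  | zero => rfl
  | succ n ih =>
    rw [pow_succ, mul_apply_eq_comp, quotientMap_mk, ih, pow_succ, mul_apply_eq_comp]

lemma OrbitCompact.quotientMap (hO : OrbitCompact T) {F : Submodule 𝕜 Y}
    [IsClosed (F : Set Y)] (hTF : Set.MapsTo T F F) : OrbitCompact (T.quotientMap F hTF) := by
  intro R x hx
  choose u hux hu using fun n => Submodule.Quotient.norm_mk_lt (x n) one_pos
  obtain ⟨k, φ, y, hφ, hy⟩ := hO (R + 1) u fun n => (hu n).le.trans (by linarith [hx n])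
  refine ⟨k, φ, Submodule.Quotient.mk y, hφ, ?_⟩
  have := (F.mkQL.continuous.tendsto y).comp hy
  refine this.congr fun n => ?_
  rw [← hux, quotientMap_pow_mk]
  rfl

/-- For the lower bound, `T` maps `F` onto `F`, so every representative of the class of `T x` is `T
(x + g)` with `g ∈ F`, and it has the norm of `x + g`. -/
lemma OrbitCompact.norm_quotientMap [CompleteSpace Y] (hO : OrbitCompact T)
    (hT : ∀ x, ‖T x‖ = ‖x‖) {F : Submodule 𝕜 Y} [hF : IsClosed (F : Set Y)]
    (hTF : Set.MapsTo T F F) (q : Y ⧸ F) : ‖T.quotientMap F hTF q‖ = ‖q‖ := by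
  apply le_antisymm
  · refine le_of_forall_pos_lt_add fun ε hε => ?_
    obtain ⟨x, rfl, hx⟩ := Submodule.Quotient.norm_mk_lt q hε
    rw [quotientMap_mk]
    exact ((Submodule.Quotient.norm_mk_le F (T x)).trans (hT x).le).trans_lt hx
  · refine le_of_forall_pos_lt_add fun ε hε => ?_
    obtain ⟨x, rfl⟩ := Submodule.Quotient.mk_surjective F q
    obtain ⟨z, hzx, hz⟩ := Submodule.Quotient.norm_mk_lt
      (T.quotientMap F hTF (Submodule.Quotient.mk x)) hε
    rw [quotientMap_mk] at hzx
    obtain ⟨g, hg, hgz⟩ := hO.surjOn hT hF hTF ((Submodule.Quotient.eq F).1 hzx)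
    have hxg : (Submodule.Quotient.mk x : Y ⧸ F) = Submodule.Quotient.mk (x + g) :=
      (Submodule.Quotient.eq F).2 (by simpa using hg)
    have hzg : z = T (x + g) := by rw [map_add, hgz]; abel
    rw [hzg, hT] at hz
    rw [hxg] at hz ⊢
    exact (Submodule.Quotient.norm_mk_le F (x + g)).trans_lt hz

/-- A Banach space carrying an isometry with compact orbit space is finite-dimensional. -/
theorem OrbitCompact.finiteDimensional [CompleteSpace Y] (hO : OrbitCompact T)
    (hT : ∀ x, ‖T x‖ = ‖x‖) : FiniteDimensional 𝕜 Y := by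
  let P := {F : Submodule 𝕜 Y // FiniteDimensional 𝕜 F ∧ Set.MapsTo T F F}
  have hclosed : ∀ F : P, IsClosed (F.1 : Set Y) := fun F => by
    have := F.2.1
    exact F.1.closed_of_finiteDimensional
  have hwf : WellFoundedGT P := by
    rw [WellFoundedGT, isWellFounded_iff, RelEmbedding.wellFounded_iff_isEmpty]
    exact ⟨fun a => hO.not_strictMono hT (V := fun n => (a n).1) (fun n => hclosed (a n))
      (fun n => (a n).2.2) (strictMono_nat_of_lt_succ fun n => a.map_rel_iff.2 n.lt_succ_self)⟩
  obtain ⟨F, hF⟩ := hwf.wf.has_min Set.univ ⟨⟨⊥, inferInstance, by simp [Set.MapsTo]⟩, trivial⟩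
  replace hF : ∀ G : P, ¬ F < G := fun G => hF.2 G trivial
  have hFcl : IsClosed (F.1 : Set Y) := hclosed F
  have hFfd := F.2.1
  have hTF := F.2.2
  by_cases hsub : Subsingleton (Y ⧸ F.1)
  · exact Module.Finite.of_submodule_quotient F.1
  · rw [not_subsingleton_iff_nontrivial] at hsub
    obtain ⟨G, hG, hGfd, hTG⟩ := (hO.quotientMap hTF).exists_finiteDimensional_invariant
      (hO.norm_quotientMap hT hTF)
    exfalso
    -- The preimage of `G` is finite-dimensional, invariant and strictly larger than the maximal
    -- `F`.
    have hle : F.1 ≤ G.comap F.1.mkQ := Submodule.le_comap_mkQ _ _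
    have hfd : FiniteDimensional 𝕜 (G.comap F.1.mkQ) := by
      refine Module.Finite.iff_fg.2 (Submodule.fg_of_fg_map_of_fg_inf_ker F.1.mkQ ?_ ?_)
      · rw [Submodule.map_comap_eq_of_surjective F.1.mkQ_surjective]
        exact Module.Finite.iff_fg.1 hGfd
      · rw [Submodule.ker_mkQ, inf_eq_right.2 hle]
        exact Module.Finite.iff_fg.1 hFfd
    refine hF ⟨G.comap F.1.mkQ, hfd, fun x hx => hTG hx⟩ (lt_of_le_of_ne hle fun h => hG ?_)
    rw [eq_bot_iff]
    intro q hq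
    obtain ⟨x, rfl⟩ := F.1.mkQ_surjective q
    have hx : x ∈ F.1 := by
      rw [Subtype.ext_iff.1 h]
      exact hq
    simpa using hx

end Quotient

/-! ### The upper-limit seminorm. -/

section AsymptoticNorm

variable {𝕜 : Type*} [RCLike 𝕜]
variable {X : Type*} [NormedAddCommGroup X] [NormedSpace 𝕜 X] {T : X →L[𝕜] X}

/-- The supremum of the norms along the orbit of `x`. -/
noncomputable def orbitNorm (T : X →L[𝕜] X) (x : X) : ℝ := ⨆ k : ℕ, ‖(T ^ k) x‖

lemma bddAbove_norm_pow (hT : PowerBounded T) (x : X) :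
    BddAbove (Set.range fun k : ℕ => ‖(T ^ k) x‖) := by
  obtain ⟨C, hC⟩ := hT
  exact ⟨C * ‖x‖, by rintro _ ⟨k, rfl⟩; exact (T ^ k).le_of_opNorm_le (hC k) x⟩

lemma norm_pow_le_orbitNorm (hT : PowerBounded T) (k : ℕ) (x : X) :
    ‖(T ^ k) x‖ ≤ orbitNorm T x :=
  le_ciSup (bddAbove_norm_pow hT x) k

lemma norm_le_orbitNorm (hT : PowerBounded T) (x : X) : ‖x‖ ≤ orbitNorm T x :=
  norm_pow_le_orbitNorm hT 0 x

lemma orbitNorm_nonneg (hT : PowerBounded T) (x : X) : 0 ≤ orbitNorm T x :=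
  (norm_nonneg x).trans (norm_le_orbitNorm hT x)

lemma orbitNorm_add_le (hT : PowerBounded T) (x y : X) :
    orbitNorm T (x + y) ≤ orbitNorm T x + orbitNorm T y :=
  ciSup_le fun k => by
    rw [map_add]
    exact (norm_add_le _ _).trans
      (add_le_add (norm_pow_le_orbitNorm hT k x) (norm_pow_le_orbitNorm hT k y))

lemma orbitNorm_smul (c : 𝕜) (x : X) : orbitNorm T (c • x) = ‖c‖ * orbitNorm T x := by
  simp only [orbitNorm, map_smul, norm_smul, Real.mul_iSup_of_nonneg (norm_nonneg c)]

lemma antitone_orbitNorm_pow (hT : PowerBounded T) (x : X) :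
    Antitone fun n : ℕ => orbitNorm T ((T ^ n) x) := by
  refine antitone_nat_of_succ_le fun n => ciSup_le fun k => ?_
  rw [← mul_apply_eq_comp, ← pow_add, add_comm n 1, ← add_assoc, pow_add, mul_apply_eq_comp]
  exact norm_pow_le_orbitNorm hT (k + 1) _

/-- The limit of `orbitNorm T ((T ^ n) x)`, that is, the upper limit of `‖(T ^ n) x‖`. -/
noncomputable def asymptoticNorm (T : X →L[𝕜] X) (x : X) : ℝ :=
  ⨅ n : ℕ, orbitNorm T ((T ^ n) x)

lemma bddBelow_orbitNorm_pow (hT : PowerBounded T) (x : X) :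
    BddBelow (Set.range fun n : ℕ => orbitNorm T ((T ^ n) x)) :=
  ⟨0, by rintro _ ⟨n, rfl⟩; exact orbitNorm_nonneg hT _⟩

lemma tendsto_orbitNorm_pow (hT : PowerBounded T) (x : X) :
    Tendsto (fun n : ℕ => orbitNorm T ((T ^ n) x)) atTop (𝓝 (asymptoticNorm T x)) :=
  tendsto_atTop_ciInf (antitone_orbitNorm_pow hT x) (bddBelow_orbitNorm_pow hT x)

/-- The seminorm `asymptoticNorm T` of a power bounded operator. -/
noncomputable def asymptoticSeminorm (T : X →L[𝕜] X) (hT : PowerBounded T) : Seminorm 𝕜 X :=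
  Seminorm.of (asymptoticNorm T)
    (fun x y => le_of_tendsto_of_tendsto' (tendsto_orbitNorm_pow hT (x + y))
      ((tendsto_orbitNorm_pow hT x).add (tendsto_orbitNorm_pow hT y)) fun n => by
        rw [map_add]; exact orbitNorm_add_le hT _ _)
    (fun c x => tendsto_nhds_unique (tendsto_orbitNorm_pow hT (c • x)) <| by
      simp only [map_smul, orbitNorm_smul]
      exact (tendsto_orbitNorm_pow hT x).const_mul _)

lemma asymptoticNorm_map (hT : PowerBounded T) (x : X) :
    asymptoticNorm T (T x) = asymptoticNorm T x := by
  refine tendsto_nhds_unique (tendsto_orbitNorm_pow hT (T x)) ?_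
  refine ((tendsto_add_atTop_iff_nat 1).2 (tendsto_orbitNorm_pow hT x)).congr fun n => ?_
  rw [pow_succ, mul_apply_eq_comp]

lemma asymptoticNorm_le {C : ℝ} (hC : ∀ n : ℕ, ‖T ^ n‖ ≤ C) (x : X) :
    asymptoticNorm T x ≤ C * ‖x‖ :=
  (ciInf_le (bddBelow_orbitNorm_pow ⟨C, hC⟩ x) 0).trans
    (ciSup_le fun k => (T ^ k).le_of_opNorm_le (hC k) x)

lemma exists_norm_pow_lt (hT : PowerBounded T) {x : X} {r : ℝ} (h : asymptoticNorm T x < r) :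
    ∃ n : ℕ, ‖(T ^ n) x‖ < r := by
  obtain ⟨n, hn⟩ := exists_lt_of_ciInf_lt h
  exact ⟨n, (norm_le_orbitNorm hT _).trans_lt hn⟩

lemma norm_le_asymptoticNorm_of_tendsto (hT : PowerBounded T) {x y : X} {ι : Type*}
    {l : Filter ι} [l.NeBot] {m : ι → ℕ} (hm : Tendsto m l atTop)
    (hy : Tendsto (fun i => (T ^ m i) x) l (𝓝 y)) : ‖y‖ ≤ asymptoticNorm T x :=
  le_of_tendsto_of_tendsto' hy.norm ((tendsto_orbitNorm_pow hT x).comp hm)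
    fun _ => norm_le_orbitNorm hT _

lemma mem_vanishingSubspace_iff (hT : PowerBounded T) {x : X} :
    x ∈ vanishingSubspace T ↔ asymptoticNorm T x = 0 := by
  constructor
  · intro hx
    obtain ⟨C, hC⟩ := id hT
    have hinv : ∀ n : ℕ, asymptoticNorm T ((T ^ n) x) = asymptoticNorm T x := by
      intro n
      induction n with
      | zero => rfl
      | succ n ih => rw [pow_succ', mul_apply_eq_comp, asymptoticNorm_map hT, ih]
    have hlim : Tendsto (fun n : ℕ => C * ‖(T ^ n) x‖) atTop (𝓝 0) := by
      simpa using (Tendsto.norm hx).const_mul C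
    -- The seminorm is constant along the orbit and at most `C * ‖T ^ n x‖`, which tends to 0.
    refine le_antisymm (ge_of_tendsto' hlim fun n => ?_) (apply_nonneg (asymptoticSeminorm T hT) x)
    rw [← hinv n]
    exact asymptoticNorm_le hC _
  · intro hx
    refine squeeze_zero_norm (fun n => norm_le_orbitNorm hT ((T ^ n) x)) ?_
    rw [← hx]
    exact tendsto_orbitNorm_pow hT x

end AsymptoticNorm

/-! ### The isometric model and orbit compactness. -/

section SeminormedCopy

variable {𝕜 : Type*} [RCLike 𝕜] {X : Type*} [AddCommGroup X] [Module 𝕜 X]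

/-- A copy of `X` carrying the topology of the seminorm `p`. -/
def SeminormedCopy (_p : Seminorm 𝕜 X) : Type _ := X

variable (p : Seminorm 𝕜 X)

noncomputable instance : SeminormedAddCommGroup (SeminormedCopy p) :=
  AddGroupSeminorm.toSeminormedAddCommGroup (E := X) p.toAddGroupSeminorm

instance : Module 𝕜 (SeminormedCopy p) := inferInstanceAs (Module 𝕜 X)

noncomputable instance : NormedSpace 𝕜 (SeminormedCopy p) where
  norm_smul_le c x := (map_smul_eq_mul p c x).le

/-- The identity map onto the copy. -/
def SeminormedCopy.of : X ≃ₗ[𝕜] SeminormedCopy p := LinearEquiv.refl 𝕜 X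

end SeminormedCopy

section Model

universe u

variable {𝕜 : Type*} [RCLike 𝕜]
variable {X : Type u} [NormedAddCommGroup X] [NormedSpace 𝕜 X] {T : X →L[𝕜] X}

/-- A power bounded operator `T` induces an isometry on the completion of `X` for the seminorm
`asymptoticNorm T`, which inherits compactness of the orbit space. -/
theorem OrbitCompact.exists_isometric_model (hO : OrbitCompact T) (hT : PowerBounded T) :
    ∃ (Y : Type u) (_ : NormedAddCommGroup Y) (_ : NormedSpace 𝕜 Y) (_ : CompleteSpace Y)
      (S : Y →L[𝕜] Y) (π : X →ₗ[𝕜] Y), (∀ y, ‖S y‖ = ‖y‖) ∧ OrbitCompact S ∧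
        (∀ x, ‖π x‖ = asymptoticNorm T x) ∧ ∀ x, π (T x) = S (π x) := by
  let p := asymptoticSeminorm T hT
  let ι : X ≃ₗ[𝕜] SeminormedCopy p := SeminormedCopy.of p
  have hι : ∀ x, ‖ι x‖ = asymptoticNorm T x := fun _ => rfl
  let S₀ : SeminormedCopy p →L[𝕜] SeminormedCopy p :=
    LinearMap.mkContinuous (ι.toLinearMap ∘ₗ T.toLinearMap ∘ₗ ι.symm.toLinearMap) 1 fun x => by
      rw [one_mul]
      exact (asymptoticNorm_map hT (ι.symm x)).le
  have hS₀ : ∀ x, S₀ (ι x) = ι (T x) := fun _ => rfl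
  let π : X →ₗ[𝕜] UniformSpace.Completion (SeminormedCopy p) :=
    (UniformSpace.Completion.toComplₗᵢ (𝕜 := 𝕜) (E := SeminormedCopy p)).toLinearMap ∘ₗ
      ι.toLinearMap
  have hπ : ∀ x, π x = ((ι x : SeminormedCopy p) : UniformSpace.Completion _) := fun _ => rfl
  have hπn : ∀ x, ‖π x‖ = asymptoticNorm T x := fun x => by
    rw [hπ, UniformSpace.Completion.norm_coe, hι]
  have hπS : ∀ x, π (T x) = S₀.completion (π x) := fun x => by
    rw [hπ, hπ, ContinuousLinearMap.completion_apply_coe, hS₀]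
  have hπS' : ∀ (n : ℕ) x, π ((T ^ n) x) = (S₀.completion ^ n) (π x) := by
    intro n
    induction n with
    | zero => intro x; rfl
    | succ n ih => intro x; rw [pow_succ, mul_apply_eq_comp, ih, hπS, pow_succ, mul_apply_eq_comp]
  have hS : ∀ y, ‖S₀.completion y‖ = ‖y‖ := by
    intro y
    induction y using UniformSpace.Completion.induction_on with
    | hp => exact isClosed_eq (S₀.completion.continuous.norm) continuous_norm
    | ih x =>
      obtain ⟨x, rfl⟩ := ι.surjective x
      rw [← hπ, ← hπS, hπn, hπn, asymptoticNorm_map hT]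
  refine ⟨_, inferInstance, inferInstance, inferInstance, S₀.completion, π, hS, ?_, hπn, hπS⟩
  intro R y hy
  have happrox : ∀ n : ℕ, ∃ x, ‖y n - π x‖ < 1 / ((n : ℝ) + 1) := fun n => by
    obtain ⟨_, ⟨x, rfl⟩, hx⟩ := Metric.mem_closure_iff.1
      (UniformSpace.Completion.denseRange_coe (y n)) (1 / ((n : ℝ) + 1)) (by positivity)
    obtain ⟨x, rfl⟩ := ι.surjective x
    exact ⟨x, by rwa [dist_eq_norm, ← hπ] at hx⟩
  choose e he using happrox
  -- `‖π (e n)‖ < R + 1` does not bound `‖e n‖`, only the upper limit along its orbit; a shift by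
  -- `j` makes the norm itself bounded, so `hO` applies.
  have hsmall : ∀ n, ∃ j : ℕ, ‖(T ^ j) (e n)‖ < R + 2 := fun n => by
    refine exists_norm_pow_lt hT ?_
    rw [← hπn]
    have h₁ : 1 / ((n : ℝ) + 1) ≤ 1 := by
      rw [div_le_one (by positivity)]
      linarith [n.cast_nonneg (α := ℝ)]
    have h₂ := norm_le_norm_add_norm_sub (y n) (π (e n))
    linarith [hy n, he n]
  choose j hj using hsmall
  obtain ⟨k, φ, z, hφ, hz⟩ := hO (R + 2) (fun n => (T ^ j n) (e n)) fun n => (hj n).le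
  refine ⟨fun n => k n + j (φ n), φ, π z, hφ, ?_⟩
  obtain ⟨C, hC⟩ := id hT
  have h₁ : Tendsto (fun n => π ((T ^ (k n + j (φ n))) (e (φ n))) - π z) atTop (𝓝 0) := by
    have h₃ : Tendsto (fun n => C * ‖(T ^ k n) ((T ^ j (φ n)) (e (φ n))) - z‖) atTop (𝓝 0) := by
      simpa using (tendsto_iff_norm_sub_tendsto_zero.1 hz).const_mul C
    refine squeeze_zero_norm (fun n => ?_) h₃
    rw [← map_sub, hπn, pow_add, mul_apply_eq_comp]
    exact asymptoticNorm_le hC _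
  have h₂ : Tendsto (fun n => (S₀.completion ^ (k n + j (φ n))) (y (φ n)) -
      π ((T ^ (k n + j (φ n))) (e (φ n)))) atTop (𝓝 0) := by
    refine squeeze_zero_norm (a := fun n : ℕ => 1 / ((φ n : ℝ) + 1)) (fun n => ?_)
      (tendsto_one_div_add_atTop_nhds_zero_nat.comp hφ.tendsto_atTop)
    rw [hπS', ← map_sub, norm_pow_apply_of_isometry hS]
    exact (he _).le
  have h₄ := (h₂.add h₁).add_const (π z)
  simpa using h₄

/-- Occasionally attracting compact sets make the orbit space compact. -/
theorem OccasionallyAttracting.orbitCompact {K : Set X} (hK : IsCompact K)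
    (hKT : OccasionallyAttracting T K) : OrbitCompact T := by
  intro R x hx
  have hR : 0 ≤ R := (norm_nonneg _).trans (hx 0)
  -- Dividing by `R + 1` moves the sequence into the unit ball and stays legitimate when `R = 0`.
  set c : 𝕜 := ((R + 1 : ℝ) : 𝕜) with hc
  have hcn : ‖c‖ = R + 1 := by rw [hc, RCLike.norm_ofReal, abs_of_pos (by positivity)]
  have hc0 : c ≠ 0 := norm_ne_zero_iff.1 (by rw [hcn]; positivity)
  have hnear : ∀ n : ℕ, ∃ k : ℕ, ∃ y ∈ K, ‖(T ^ k) (c⁻¹ • x n) - y‖ < 1 / ((n : ℝ) + 1) := by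
    intro n
    have hball : ‖c⁻¹ • x n‖ ≤ 1 := by
      rw [norm_smul, norm_inv, hcn, inv_mul_le_one₀ (by positivity)]
      linarith [hx n]
    have hpos : (0 : ENNReal) < ENNReal.ofReal (1 / ((n : ℝ) + 1)) :=
      ENNReal.ofReal_pos.2 (by positivity)
    obtain ⟨k, hk⟩ := (frequently_lt_of_liminf_lt (by isBoundedDefault)
      ((hKT _ hball).trans_lt hpos)).exists
    obtain ⟨y, hyK, hy⟩ := Metric.infEDist_lt_iff.1 hk
    refine ⟨k, y, hyK, ?_⟩
    rwa [edist_dist, ENNReal.ofReal_lt_ofReal_iff (by positivity), dist_eq_norm] at hy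
  choose k y hyK hy using hnear
  obtain ⟨z, -, φ, hφ, hz⟩ := hK.tendsto_subseq hyK
  refine ⟨fun n => k (φ n), φ, c • z, hφ, ?_⟩
  have h₁ : Tendsto (fun n => (T ^ k (φ n)) (c⁻¹ • x (φ n)) - y (φ n)) atTop (𝓝 0) :=
    squeeze_zero_norm (a := fun n : ℕ => 1 / ((φ n : ℝ) + 1)) (fun n => (hy _).le)
      (tendsto_one_div_add_atTop_nhds_zero_nat.comp hφ.tendsto_atTop)
  have h₂ := (h₁.add hz).const_smul c
  simpa [smul_smul, hc0] using h₂

end Model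

/-! ### Returning vectors. -/

section Returning

variable {𝕜 : Type*} [RCLike 𝕜]
variable {X : Type*} [NormedAddCommGroup X] [NormedSpace 𝕜 X] {T : X →L[𝕜] X}

lemma isReturning_iff_frequently {a : X} :
    IsReturning T a ↔ ∀ ε > 0, ∃ᶠ n : ℕ in atTop, ‖(T ^ n) a - a‖ < ε := by
  constructor
  · intro h ε hε
    refine (frequently_lt_of_liminf_lt (by isBoundedDefault)
      (h.trans_lt (ENNReal.ofReal_pos.2 hε))).mono fun n hn => ?_
    rwa [← ofReal_norm, ENNReal.ofReal_lt_ofReal_iff hε] at hn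
  · intro h
    refine le_antisymm (le_of_forall_gt fun c hc => ?_) bot_le
    obtain ⟨ε, hε, hεc⟩ := ENNReal.lt_iff_exists_nnreal_btwn.1 hc
    refine (liminf_le_of_frequently_le' (u := fun n : ℕ => ‖(T ^ n) a - a‖ₑ) (x := (ε : ENNReal)) <|
      (h ε (by exact_mod_cast hε)).mono fun n hn => ?_).trans_lt hεc
    rw [← ofReal_norm]
    exact (ENNReal.ofReal_le_ofReal hn.le).trans_eq (ENNReal.ofReal_coe_nnreal)

lemma IsReturning.apply (S : X →L[𝕜] X) (hS : Commute S T) {a : X} (ha : IsReturning T a) :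
    IsReturning T (S a) := by
  rw [isReturning_iff_frequently] at ha ⊢
  intro ε hε
  refine (ha (ε / (‖S‖ + 1)) (by positivity)).mono fun n hn => ?_
  rw [← mul_apply_eq_comp, ← (hS.pow_right n).eq, mul_apply_eq_comp, ← map_sub]
  rw [lt_div_iff₀ (by positivity)] at hn
  nlinarith [S.le_opNorm ((T ^ n) a - a), norm_nonneg ((T ^ n) a - a)]

/-- At late return times `‖T ^ n a‖` is close to `‖a‖`, while `orbitNorm T (T ^ n a)` is close to
its limit. -/
lemma IsReturning.norm_le_asymptoticNorm (hT : PowerBounded T) {a : X} (ha : IsReturning T a) :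
    ‖a‖ ≤ asymptoticNorm T a := by
  rw [isReturning_iff_frequently] at ha
  refine le_of_forall_pos_le_add fun ε hε => ?_
  obtain ⟨n, hn, hn'⟩ := ((ha (ε / 2) (by positivity)).and_eventually
    ((tendsto_orbitNorm_pow hT a).eventually_lt_const
      (show asymptoticNorm T a < asymptoticNorm T a + ε / 2 by linarith))).exists
  have h₁ := norm_le_norm_add_norm_sub ((T ^ n) a) a
  linarith [norm_le_orbitNorm hT ((T ^ n) a)]

/-- Powers of an isometry of a finite-dimensional space return to the identity. -/
lemma frequently_norm_pow_sub_one_lt {Y : Type*} [NormedAddCommGroup Y] [NormedSpace 𝕜 Y]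
    [FiniteDimensional 𝕜 Y] {S : Y →L[𝕜] Y} (hS : ∀ y, ‖S y‖ = ‖y‖) {ε : ℝ} (hε : 0 < ε) :
    ∃ᶠ n : ℕ in atTop, ‖S ^ n - 1‖ < ε := by
  have : ProperSpace (Y →L[𝕜] Y) := FiniteDimensional.proper 𝕜 _
  -- The powers lie in a compact ball of operators; two close powers, with the smaller one
  -- cancelled, give a power close to the identity.
  obtain ⟨U, -, φ, hφ, hU⟩ := tendsto_subseq_of_bounded (x := fun n : ℕ => S ^ n)
    (Metric.isBounded_closedBall (x := 0) (r := 1)) fun n => by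
      simpa using norm_pow_le_one_of_isometry hS n
  obtain ⟨N, hN⟩ := Metric.cauchySeq_iff.1 hU.cauchySeq (ε / 2) (by positivity)
  rw [frequently_atTop]
  intro m
  obtain ⟨n, hn, hmn⟩ :=
    ((eventually_ge_atTop N).and (hφ.tendsto_atTop.eventually_ge_atTop (φ N + m))).exists
  refine ⟨φ n - φ N, by omega, ?_⟩
  have h := hN n hn N le_rfl
  have hφn : φ n = φ N + (φ n - φ N) := by omega
  rw [dist_eq_norm, Function.comp_apply, Function.comp_apply, hφn, pow_add] at h
  refine lt_of_le_of_lt ?_ (half_lt_self hε)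
  refine ContinuousLinearMap.opNorm_le_bound _ (by positivity) fun y => ?_
  rw [← norm_pow_apply_of_isometry hS (φ N)]
  refine le_trans (le_of_eq ?_) ((S ^ φ N * S ^ (φ n - φ N) - S ^ φ N).le_of_opNorm_le h.le y)
  congr 1
  simp only [sub_apply, mul_apply_eq_comp, map_sub]
  rfl

variable {Y : Type*} [NormedAddCommGroup Y] [NormedSpace 𝕜 Y]

/-- The filter of all times which tend to infinity and along which the powers of `S` tend to the
identity. -/
noncomputable def returnFilter (S : Y →L[𝕜] Y) : Filter ℕ :=
  atTop ⊓ comap (fun n : ℕ => ‖S ^ n - 1‖) (𝓝 0)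

lemma returnFilter_neBot [FiniteDimensional 𝕜 Y] {S : Y →L[𝕜] Y} (hS : ∀ y, ‖S y‖ = ‖y‖) :
    (returnFilter S).NeBot := by
  rw [returnFilter, inf_neBot_iff_frequently_right]
  intro P hP
  obtain ⟨s, hs, hsP⟩ := mem_comap.1 hP
  obtain ⟨ε, hε, hεs⟩ := Metric.mem_nhds_iff.1 hs
  exact (frequently_norm_pow_sub_one_lt hS hε).mono fun n hn => hsP (hεs (by simpa using hn))

/-- The vectors which return along `returnFilter S`. -/
def returningSubmodule (T : X →L[𝕜] X) (S : Y →L[𝕜] Y) : Submodule 𝕜 X where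
  carrier := {a | Tendsto (fun n : ℕ => (T ^ n) a) (returnFilter S) (𝓝 a)}
  zero_mem' := by simpa using! tendsto_const_nhds
  add_mem' {a b} ha hb := by
    change Tendsto _ _ _
    simp only [map_add]
    exact Tendsto.add ha hb
  smul_mem' c a ha := by
    change Tendsto _ _ _
    simp only [map_smul]
    exact Tendsto.const_smul ha c

lemma mem_returningSubmodule_of_norm_le {S : Y →L[𝕜] Y} {a : X} {c : ℝ}
    (h : ∀ n : ℕ, ‖(T ^ n) a - a‖ ≤ ‖S ^ n - 1‖ * c) : a ∈ returningSubmodule T S := by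
  change Tendsto _ _ _
  rw [tendsto_iff_norm_sub_tendsto_zero]
  have h₀ : Tendsto (fun n : ℕ => ‖S ^ n - 1‖) (returnFilter S) (𝓝 0) :=
    tendsto_comap.mono_left inf_le_right
  exact squeeze_zero (fun n => norm_nonneg _) h (by simpa using h₀.mul_const c)

lemma isReturning_of_mem_returningSubmodule {S : Y →L[𝕜] Y} [(returnFilter S).NeBot] {a : X}
    (ha : a ∈ returningSubmodule T S) : IsReturning T a := by
  rw [isReturning_iff_frequently]
  intro ε hε
  have h := (tendsto_iff_norm_sub_tendsto_zero.1 ha).eventually_lt_const hε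
  exact h.frequently.filter_mono inf_le_left

end Returning

/-! ### The decomposition. -/

theorem theorem2 {𝕜 X : Type*} [RCLike 𝕜] [NormedAddCommGroup X] [NormedSpace 𝕜 X]
    [CompleteSpace X] (T : X →L[𝕜] X) (hT : PowerBounded T)
    (hK : ∃ K : Set X, IsCompact K ∧ OccasionallyAttracting T K) :
    ∃ L : Submodule 𝕜 X,
      Set.MapsTo T L L ∧
      FiniteDimensional 𝕜 L ∧
      L = Submodule.span 𝕜 {a : X | IsReturning T a} ∧
      (∀ x : X, Tendsto (fun n : ℕ => Metric.infEDist ((T ^ n) x) (L : Set X)) atTop (𝓝 0)) ∧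
      DecomposesAlong T (vanishingSubspace T) L := by
  obtain ⟨K, hK, hKT⟩ := hK
  have hO := hKT.orbitCompact hK
  obtain ⟨C, hC⟩ := id hT
  obtain ⟨Y, _, _, _, S, π, hS, hOS, hπ, hπS⟩ := hO.exists_isometric_model hT
  have hfd : FiniteDimensional 𝕜 Y := hOS.finiteDimensional hS
  have hne : (returnFilter S).NeBot := returnFilter_neBot hS
  have hπS' : ∀ (n : ℕ) x, π ((T ^ n) x) = (S ^ n) (π x) := by
    intro n
    induction n with
    | zero => intro x; rfl
    | succ n ih => intro x; rw [pow_succ, mul_apply_eq_comp, ih, hπS, pow_succ, mul_apply_eq_comp]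
  have hbound : ∀ (n : ℕ) x, asymptoticNorm T ((T ^ n) x - x) ≤ ‖S ^ n - 1‖ * ‖π x‖ := by
    intro n x
    rw [← hπ, map_sub, hπS']
    exact (S ^ n - 1).le_opNorm (π x)
  have hcomm : ∀ n : ℕ, Commute (T ^ n - 1) T := fun n =>
    ((Commute.refl T).pow_left n).sub_left (Commute.one_left T)
  -- If `a` returns, so does `T ^ n a - a`; its norm is thus at most its seminorm, which `‖S ^ n -
  -- 1‖` controls. So `a` returns along the common filter.
  have hmem : ∀ a, a ∈ returningSubmodule T S ↔ IsReturning T a := fun a =>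
    ⟨isReturning_of_mem_returningSubmodule, fun ha => mem_returningSubmodule_of_norm_le fun n =>
      ((ha.apply _ (hcomm n)).norm_le_asymptoticNorm hT).trans (hbound n a)⟩
  set L := returningSubmodule T S
  have hTL : Set.MapsTo T L L := fun a ha =>
    (hmem _).2 (((hmem a).1 ha).apply T (Commute.refl T))
  have hker : ∀ x, x ∈ vanishingSubspace T ↔ π x = 0 := fun x => by
    rw [mem_vanishingSubspace_iff hT, ← hπ, norm_eq_zero]
  have hπcont : Continuous π :=
    AddMonoidHomClass.continuous_of_bound π C fun x => (hπ x).trans_le (asymptoticNorm_le hC x)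
  have hclosed : IsClosed (vanishingSubspace T : Set X) := by
    convert isClosed_singleton (x := (0 : Y)).preimage hπcont using 1
    ext x
    simpa using hker x
  have hdisj : ∀ a ∈ L, π a = 0 → a = 0 := fun a ha h0 => by
    have h := ((hmem a).1 ha).norm_le_asymptoticNorm hT
    rw [← hπ, h0, norm_zero] at h
    exact norm_le_zero_iff.1 h
  have hLfd : FiniteDimensional 𝕜 L := by
    refine FiniteDimensional.of_injective (π ∘ₗ L.subtype) ?_
    rw [injective_iff_map_eq_zero]
    exact fun a ha => Subtype.ext (hdisj a a.2 ha)
  have hsurj : ∀ x, ∃ a ∈ L, π a = π x := by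
    intro x
    obtain ⟨m, y, hm, hy⟩ := hO.exists_tendsto hC x
    -- `T ^ n y - y` is a limit point of the orbit of `T ^ n x - x`, so its norm is at most the
    -- seminorm of the latter.
    have hyL : y ∈ L := mem_returningSubmodule_of_norm_le fun n =>
      (norm_le_asymptoticNorm_of_tendsto hT hm (x := (T ^ n) x - x) <| by
        refine (((T ^ n - 1).continuous.tendsto y).comp hy).congr fun i => ?_
        have h := DFunLike.congr_fun (((hcomm n).pow_right (m i)).eq) x
        exact h).trans (hbound n x)
    have hTM : Set.MapsTo S (L.map π) (L.map π : Submodule 𝕜 Y) := by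
      rintro _ ⟨a, ha, rfl⟩
      exact ⟨T a, hTL ha, hπS a⟩
    have hMcl : IsClosed (L.map π : Set Y) := (L.map π).closed_of_finiteDimensional
    change π x ∈ L.map π
    -- The distance from `(S ^ k) (π x)` to `π(L)` does not fall below its initial value, yet these
    -- points approach `π y ∈ π(L)` along `m`.
    by_contra hx
    have hpos : 0 < Metric.infDist (π x) (L.map π) :=
      (hMcl.notMem_iff_infDist_pos ⟨0, zero_mem _⟩).1 hx
    have hle : ∀ z ∈ L.map π, Metric.infDist (π x) (L.map π) ≤ ‖π x - z‖ := fun z hz => by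
      rw [← dist_eq_norm]
      exact Metric.infDist_le_dist_of_mem hz
    have hlim : Tendsto (fun n => ‖(S ^ m n) (π x) - π y‖) atTop (𝓝 0) := by
      rw [← tendsto_iff_norm_sub_tendsto_zero]
      exact ((hπcont.tendsto y).comp hy).congr fun n => hπS' _ _
    exact hpos.not_ge (ge_of_tendsto' hlim fun n =>
      hOS.le_norm_pow_sub hS hMcl hTM hle (m n) _ ⟨y, hyL, rfl⟩)
  have hcompl : IsCompl (vanishingSubspace T) L := by
    refine ⟨Submodule.disjoint_def.2 fun x hx hxL => hdisj x hxL ((hker x).1 hx),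
      codisjoint_iff_le_sup.2 fun x _ => ?_⟩
    obtain ⟨a, ha, hax⟩ := hsurj x
    exact Submodule.mem_sup.2 ⟨x - a, (hker _).2 (by rw [map_sub, hax, sub_self]), a, ha,
      sub_add_cancel x a⟩
  have hT₀ : Set.MapsTo T (vanishingSubspace T) (vanishingSubspace T) := fun x hx =>
    (hker _).2 (by rw [hπS, (hker x).1 hx, map_zero])
  have hrestrict : ∀ (F : Submodule 𝕜 X) (hF : Set.MapsTo T F F) (n : ℕ) (x : F),
      (((T.restrict hF) ^ n) x : X) = (T ^ n) (x : X) := by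
    intro F hF n
    induction n with
    | zero => intro x; rfl
    | succ n ih => intro x; rw [pow_succ, mul_apply_eq_comp, ih, pow_succ, mul_apply_eq_comp]; rfl
  refine ⟨L, hTL, hLfd, ?_, ?_, ?_, hT₀, hTL, ?_⟩
  · exact le_antisymm
      (fun a ha => Submodule.subset_span (s := {a | IsReturning T a}) ((hmem a).1 ha))
      (Submodule.span_le.2 fun a ha => (hmem a).2 ha)
  · intro x
    obtain ⟨a, ha, hax⟩ := hsurj x
    have hx : x - a ∈ vanishingSubspace T := (hker _).2 (by rw [map_sub, hax, sub_self])
    have hlim : Tendsto (fun n : ℕ => ‖(T ^ n) (x - a)‖ₑ) atTop (𝓝 0) := by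
      simpa using Tendsto.enorm hx
    refine tendsto_of_tendsto_of_tendsto_of_le_of_le tendsto_const_nhds hlim
      (fun n => bot_le) fun n => ?_
    refine (Metric.infEDist_le_edist_of_mem (mapsTo_pow hTL n ha)).trans_eq ?_
    rw [edist_eq_enorm_sub, ← map_sub]
  · exact Submodule.IsCompl.isTopCompl_of_isClosed_of_finiteDimensional hcompl hclosed
  · intro n x₀ l
    rw [map_add, hrestrict, hrestrict]
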